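/- **Setting.** Let $N\ge 2$, $a^{(k)}=(k-\tfrac12)/N$ for $k\in\{1,\dots,N\}$, let $\mathcal X$ be a measurable space, and let $\mathbf Q$ be a probability distribution on $\mathcal X\times\{0,1\}$ with marginals $\gamma_s=\mathbf Q(\mathcal X\times\{s\})>0$ for $s\in\{0,1\}$. Nature's monitoring is a measurable map $G$ on $\mathcal X\times\{0,1\}$; this covers $G(x,s)=x$ (Nature unaware of $s$) and $G(x,s)=(x,s)$ (Nature aware of $s$). At each round $t\ge1$: contexts $(x_t,s_t)\sim\mathbf Q$ are drawn independently of the past; the Player, who sees $x_t$, and Nature, who sees $G(x_t,s_t)$, simultaneously and independently draw $k_t\in\{1,\dots,N\}$ and $b_t\in\{0,1\}$ from distributions that depend measurably on what they see and on their information about the past. That information is the full past history $(x_{t'},s_{t'},k_{t'},b_{t'})_{t'<t}$ for Nature, and the past contexts $(x_{t'},s_{t'})_{t'<t}$ and payoff vectors $m(k_{t'},b_{t'},s_{t'})$, $t'<t$, for the Player. Here $m=(m^{\mathrm{cal}},m^{\mathrm{dp}})\in\mathbb R^N\times\mathbb R^2$ with $$m^{\mathrm{cal}}(k,b)=\bigl((a^{(k')}-b)\mathbf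 1\{k=k'\}\bigr)_{1\le k'\le N},\qquad m^{\mathrm{dp}}(k,s)=\bigl(a^{(k)}\mathbf 1\{s=0\}/\gamma_0,\ a^{(k)}\mathbf 1\{s=1\}/\gamma_1\bigr).$$ The target is $\mathcal C=\mathcal C^{\mathrm{cal}}\times\mathcal C^{\mathrm{dp}}$ with $\mathcal C^{\mathrm{cal}}=\{v\in\mathbb R^N:\|v\|_1\le 1/N\}$ and $\mathcal C^{\mathrm{dp}}=\{(u,v)\in\mathbb R^2:|u-v|\le1/N\}$. Write $\bar m_T=\frac1T\sum_{t=1}^T m(k_t,b_t,s_t)$. The set $\mathcal C$ is called *approachable* under $\mathbf Q$ and $G$ if some strategy of the Player ensures, against every strategy of Nature, that the Euclidean distance of $\bar m_T$ to $\mathcal C$ tends to $0$ almost surely. Extend $m$ linearly to distributions $p$ over $\{1,\dots,N\}$ and $q$ over $\{0,1\}$. **Statement.** 1. For all such $\mathbf Q$ and $G$: * Blackwell's condition holds: for every measurable family $(q^{G(x,s)})$ of distributions over $\{0,1\}$ there is a measurable family $(p^x)$ of distributions over $\{1,\dots,N\}$ with $\int m(p^x,q^{G(x,s)},s)\,d\mathbf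 Q(x,s)\in\mathcal C$; * the constant family $p^x=\delta_k$ is such a family whenever $a^{(k)}$ is a grid point closest to $\int q^{G(x,s)}(1)\,d\mathbf Q(x,s)$; * $\mathcal C$ is approachable under $\mathbf Q$ and $G$. 2. Vanilla $1/N$-calibration and demographic parity are simultaneously achievable: there is a single strategy of the Player, depending on neither $\mathbf Q$ nor $G$, such that for all such $\mathbf Q$ and $G$ and every strategy of Nature, almost surely, the distance of $\bar m_T$ to $\mathcal C$ tends to $0$, $$\limsup_{T\to\infty}\ \sum_{k=1}^N\Bigl|\frac1T\sum_{t=1}^T(a^{(k)}-b_t)\mathbf 1\{k_t=k\}\Bigr|\le\frac1N$$ and $$\limsup_{T\to\infty}\ \Bigl|\frac1{\gamma_0T}\sum_{t=1}^Ta^{(k_t)}\mathbf 1\{s_t=0\}-\frac1{\gamma_1T}\sum_{t=1}^Ta^{(k_t)}\mathbf 1\{s_t=1\}\Bigr|\le\frac1N .$$ -/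

import Mathlib

open MeasureTheory ProbabilityTheory Filter Topology

universe u

namespace FairOnline

/-! ## The repeated game with stochastic contexts -/

section Game

variable {X S A B Γ ι : Type*}

/-- What happens in one round: the contexts `(x, s)`, then the actions `(a, b)` of the Player and
of Nature. -/
abbrev Round (X S A B : Type*) : Type _ := (X × S) × (A × B)

/-- What the Player learns in one round: the vector payoff and the contexts `(x, s)`. -/
abbrev PlayerObs (X S ι : Type*) : Type _ := EuclideanSpace ℝ ι × (X × S)

/-- A bounded measurable vector-valued payoff function `m(a, b, x, s)`. -/
structure Payoff (X S A B ι : Type*) [Fintype ι] [MeasurableSpace X] [MeasurableSpace S]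
    [MeasurableSpace A] [MeasurableSpace B] where
  /-- The payoff vector. -/
  toFun : A → B → X → S → EuclideanSpace ℝ ι
  measurable_toFun : Measurable fun r : Round X S A B => toFun r.2.1 r.2.2 r.1.1 r.1.2
  bounded_toFun : ∃ M : ℝ, ∀ a b x s, ‖toFun a b x s‖ ≤ M

variable [Fintype ι] [MeasurableSpace X] [MeasurableSpace S] [MeasurableSpace A]
  [MeasurableSpace B] [MeasurableSpace Γ]

/-- What the Player observes of a round. -/
def Payoff.obs (m : Payoff X S A B ι) (r : Round X S A B) : PlayerObs X S ι :=
  (m.toFun r.2.1 r.2.2 r.1.1 r.1.2, r.1)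

lemma Payoff.measurable_obs (m : Payoff X S A B ι) : Measurable m.obs :=
  m.measurable_toFun.prodMk measurable_fst

/-- A strategy of the Player: after `n` rounds, given what was observed in these rounds and the new
non-sensitive context `x`, a probability distribution over `A`, all in a measurable way. -/
structure PlayerStrategy (X S A ι : Type*) [Fintype ι] [MeasurableSpace X] [MeasurableSpace S]
    [MeasurableSpace A] where
  /-- The mixed action for the round that follows `n` completed rounds. -/
  act : (n : ℕ) → Kernel ((Fin n → PlayerObs X S ι) × X) A
  isMarkov : ∀ n, IsMarkovKernel (act n)

/-- A strategy of Nature: after `n` rounds, given the full history of these rounds and the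
observation in `Γ` of the new contexts, a probability distribution over `B`, all in a measurable
way. -/
structure NatureStrategy (X S A B Γ : Type*) [MeasurableSpace X] [MeasurableSpace S]
    [MeasurableSpace A] [MeasurableSpace B] [MeasurableSpace Γ] where
  /-- The mixed action for the round that follows `n` completed rounds. -/
  act : (n : ℕ) → Kernel ((Fin n → Round X S A B) × Γ) B
  isMarkov : ∀ n, IsMarkovKernel (act n)

/-- The conditional law of the next round given the first `n` rounds: the contexts are drawn from
`Q`, independently of the past; given them, the Player and Nature draw their actions
independently of each other. -/
noncomputable def roundKernel (Q : Measure (X × S)) (m : Payoff X S A B ι)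
    (G : X × S → Γ) (hG : Measurable G) (σ : PlayerStrategy X S A ι)
    (τ : NatureStrategy X S A B Γ) (n : ℕ) :
    Kernel (Fin n → Round X S A B) (Round X S A B) :=
  (Kernel.const (Fin n → Round X S A B) Q) ⊗ₖ
    (((σ.act n).comap
        (fun p : (Fin n → Round X S A B) × (X × S) => ((fun i => m.obs (p.1 i)), p.2.1))
        (Measurable.prodMk
          (measurable_pi_lambda _ fun i =>
            m.measurable_obs.comp ((measurable_pi_apply i).comp measurable_fst))
          (measurable_fst.comp measurable_snd))) ×ₖ
      ((τ.act n).comap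
        (fun p : (Fin n → Round X S A B) × (X × S) => (p.1, G p.2))
        (measurable_fst.prodMk (hG.comp measurable_snd))))

instance (Q : Measure (X × S)) [IsProbabilityMeasure Q] (m : Payoff X S A B ι)
    (G : X × S → Γ) (hG : Measurable G) (σ : PlayerStrategy X S A ι)
    (τ : NatureStrategy X S A B Γ) (n : ℕ) : IsMarkovKernel (roundKernel Q m G hG σ τ n) := by
  have := σ.isMarkov n
  have := τ.isMarkov n
  unfold roundKernel
  infer_instance

/-- The law of the sequence of rounds `ω 0, ω 1, …` of the game. -/
noncomputable def playLaw (Q : Measure (X × S)) [IsProbabilityMeasure Q] (m : Payoff X S A B ι)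
    (G : X × S → Γ) (hG : Measurable G) (σ : PlayerStrategy X S A ι)
    (τ : NatureStrategy X S A B Γ) : Measure (ℕ → Round X S A B) :=
  Kernel.trajMeasure (X := fun _ => Round X S A B)
    (roundKernel Q m G hG σ τ 0 Fin.elim0)
    (fun n => (roundKernel Q m G hG σ τ (n + 1)).comap
      (fun (h : (i : Finset.Iic n) → Round X S A B) (i : Fin (n + 1)) =>
        h ⟨i, Finset.mem_Iic.2 (Nat.lt_succ_iff.1 i.isLt)⟩)
      (measurable_pi_lambda _ fun _ => measurable_pi_apply _))

/-- The average payoff of the first `T` rounds. -/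
noncomputable def avgPayoff (m : Payoff X S A B ι) (ω : ℕ → Round X S A B) (T : ℕ) :
    EuclideanSpace ℝ ι :=
  (T : ℝ)⁻¹ • ∑ t ∈ Finset.range T,
    m.toFun (ω t).2.1 (ω t).2.2 (ω t).1.1 (ω t).1.2

/-- The set `C` is approachable under `Q`, for the monitoring `G` of Nature: some strategy of the
Player ensures, against all strategies of Nature, that the distance of the average payoff to `C`
tends to `0` almost surely. -/
def Approachable (Q : Measure (X × S)) [IsProbabilityMeasure Q] (m : Payoff X S A B ι)
    (G : X × S → Γ) (hG : Measurable G) (C : Set (EuclideanSpace ℝ ι)) : Prop :=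
  ∃ σ : PlayerStrategy X S A ι, ∀ τ : NatureStrategy X S A B Γ,
    ∀ᵐ ω ∂(playLaw Q m G hG σ τ),
      Tendsto (fun T => Metric.infDist (avgPayoff m ω T) C) atTop (𝓝 0)

/-- The expected payoff `∫ m(p^x, q^{G(x,s)}, x, s) dQ(x, s)`, with `m` extended linearly to
probability distributions over the actions. -/
noncomputable def meanPayoff [Fintype A] [Fintype B] (Q : Measure (X × S)) (m : Payoff X S A B ι)
    (G : X × S → Γ) (p : Kernel X A) (q : Kernel Γ B) : EuclideanSpace ℝ ι :=
  ∫ z, ∑ a, ∑ b, ((p z.1).real {a} * (q (G z)).real {b}) • m.toFun a b z.1 z.2 ∂Q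

/-- Blackwell's condition: for every measurable family `(q^{G(x,s)})` of distributions over `B`
there is a measurable family `(p^x)` of distributions over `A` with expected payoff in `C`. -/
def BlackwellCondition [Fintype A] [Fintype B] (Q : Measure (X × S)) (m : Payoff X S A B ι)
    (G : X × S → Γ) (C : Set (EuclideanSpace ℝ ι)) : Prop :=
  ∀ q : Kernel Γ B, IsMarkovKernel q →
    ∃ p : Kernel X A, IsMarkovKernel p ∧ meanPayoff Q m G p q ∈ C

end Game

/-! ## Calibration and demographic parity

The Player picks `k : Fin N` and forecasts `gridPoint N k`; outcomes and sensitive contexts are in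
`{0, 1}`, that is, in `Fin 2`. -/

/-- The grid point `(k - 1/2) / N`, where `k` is numbered from `1`. -/
noncomputable def gridPoint (N : ℕ) (k : Fin N) : ℝ := ((k : ℝ) + 1 / 2) / N

/-- The outcome `b ∈ {0, 1}` as a real number. -/
def outcome (b : Fin 2) : ℝ := ((b : ℕ) : ℝ)

section Criteria

variable {X : Type*} [MeasurableSpace X]

/-- The probability `γ_s` that the sensitive context equals `s`. -/
noncomputable def groupProb (Q : Measure (X × Fin 2)) (s : Fin 2) : ℝ :=
  Q.real {z | z.2 = s}

/-- The calibration payoff, in `ℝ^N`. -/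
noncomputable def calPayoff (N : ℕ) (k : Fin N) (b : Fin 2) : EuclideanSpace ℝ (Fin N) :=
  WithLp.toLp 2 fun k' => if k' = k then gridPoint N k' - outcome b else 0

/-- The demographic parity payoff, in `ℝ^2`. -/
noncomputable def dpPayoff (Q : Measure (X × Fin 2)) (N : ℕ) (k : Fin N) (s : Fin 2) :
    EuclideanSpace ℝ (Fin 2) :=
  WithLp.toLp 2 fun s' => if s = s' then gridPoint N k / groupProb Q s' else 0

/-- The calibration target: the vectors of `ℓ¹` norm at most `1/N`. -/
def calTarget (N : ℕ) : Set (EuclideanSpace ℝ (Fin N)) := {v | ∑ k, |v k| ≤ 1 / (N : ℝ)}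

/-- The demographic parity target. -/
def dpTarget (N : ℕ) : Set (EuclideanSpace ℝ (Fin 2)) := {w | |w 0 - w 1| ≤ 1 / (N : ℝ)}

/-- The payoff `(m^cal, m^dp)`, in `ℝ^(N+2) = ℝ^N × ℝ^2` with its Euclidean norm. -/
noncomputable def calDpPayoff (Q : Measure (X × Fin 2)) (N : ℕ) :
    Payoff X (Fin 2) (Fin N) (Fin 2) (Fin N ⊕ Fin 2) where
  toFun k b _ s := WithLp.toLp 2 (Sum.elim (calPayoff N k b) (dpPayoff Q N k s))
  measurable_toFun :=
    (measurable_of_countable fun y : Fin 2 × (Fin N × Fin 2) =>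
      (WithLp.toLp 2 (Sum.elim (calPayoff N y.2.1 y.2.2) (dpPayoff Q N y.2.1 y.1)) :
        EuclideanSpace ℝ (Fin N ⊕ Fin 2))).comp
      ((measurable_snd.comp measurable_fst).prodMk measurable_snd)
  bounded_toFun := by
    obtain ⟨M, hM⟩ := (Set.finite_range fun y : Fin N × Fin 2 × Fin 2 =>
      ‖(WithLp.toLp 2 (Sum.elim (calPayoff N y.1 y.2.1) (dpPayoff Q N y.1 y.2.2)) :
        EuclideanSpace ℝ (Fin N ⊕ Fin 2))‖).bddAbove
    exact ⟨M, fun a b _ s => hM ⟨(a, b, s), rfl⟩⟩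

/-- The product target `C^cal × C^dp`, in `ℝ^N × ℝ^2`. -/
def calDpTarget (N : ℕ) : Set (EuclideanSpace ℝ (Fin N ⊕ Fin 2)) :=
  {w | (WithLp.toLp 2 fun k => w (Sum.inl k)) ∈ calTarget N ∧
    (WithLp.toLp 2 fun s => w (Sum.inr s)) ∈ dpTarget N}

/-- The calibration criterion `C_T`. -/
noncomputable def calError {N : ℕ} (ω : ℕ → Round X (Fin 2) (Fin N) (Fin 2)) (T : ℕ) : ℝ :=
  ∑ k : Fin N, |1 / (T : ℝ) * ∑ t ∈ Finset.range T,
    if (ω t).2.1 = k then gridPoint N k - outcome (ω t).2.2 else 0|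

/-- The demographic parity criterion `D_T`. -/
noncomputable def dpGap (Q : Measure (X × Fin 2)) {N : ℕ}
    (ω : ℕ → Round X (Fin 2) (Fin N) (Fin 2)) (T : ℕ) : ℝ :=
  |1 / (groupProb Q 0 * T) * (∑ t ∈ Finset.range T,
      if (ω t).1.2 = 0 then gridPoint N (ω t).2.1 else 0) -
    1 / (groupProb Q 1 * T) * (∑ t ∈ Finset.range T,
      if (ω t).1.2 = 1 then gridPoint N (ω t).2.1 else 0)|

end Criteria

end FairOnline

namespace FairOnline

/-! ## Almost sure convergence from second moments -/

section Convergence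

/-! One strategy that ignores every context serves all `Q` and `G`. Since it ignores `x`, the
forecast is independent of the new sensitive context given the past. Each increment of the signed
parity gap therefore has conditional mean `E[a] * ∫ groupWeight = 0`, and the gap per round vanishes
whatever the forecasts are (`integral_dpSum_mul_nonpos`).

Calibration is then a context-free Blackwell argument. Each grid point has a budget of `1 / (2N)`
per use, and the potential is the sum of the squared cumulated errors in excess of these budgets.
Its first-order drift is `weightedExcess`. A forecast on one grid point, or on two neighbouring
ones, makes this nonpositive in mean for both outcomes (`exists_mixture_of_pattern`). Both processes
thus have second moments `O(T)` and bounded increments, hence are almost surely `o(T)`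
(`ae_tendsto_div_of_sum_sq_succ_le`).

The budgets add up to `T / (2N)`, half the target. The slack makes both criteria eventually at most
`1 / N`, so the average payoff eventually lies in the target, which gives the distance and both
limsups.

Blackwell's condition is a separate computation: a constant forecast has equal parity coordinates
and a single calibration error, its distance to the mean outcome. -/

lemma abs_sub_le_mul_of_abs_succ_sub_le {u : ℕ → ℝ} {C : ℝ} (h : ∀ n, |u (n + 1) - u n| ≤ C)
    (m k : ℕ) : |u (m + k) - u m| ≤ C * k := by
  induction k with
  | zero => simp
  | succ k ih =>
    have := abs_add_le (u (m + k + 1) - u (m + k)) (u (m + k) - u m)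
    have h' := h (m + k)
    rw [sub_add_sub_cancel] at this
    push_cast
    rw [← add_assoc]
    linarith

lemma abs_le_mul_of_abs_succ_sub_le {u : ℕ → ℝ} {C : ℝ} (h0 : u 0 = 0)
    (h : ∀ n, |u (n + 1) - u n| ≤ C) (n : ℕ) : |u n| ≤ C * n := by
  simpa [h0] using abs_sub_le_mul_of_abs_succ_sub_le h 0 n

/-- A sequence with bounded increments is `o(n)` if it is along the squares. -/
lemma tendsto_div_of_tendsto_sq {u : ℕ → ℝ} {C : ℝ} (h : ∀ n, |u (n + 1) - u n| ≤ C)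
    (hsq : Tendsto (fun n : ℕ => |u (n ^ 2)| / (n : ℝ) ^ 2) atTop (𝓝 0)) :
    Tendsto (fun n : ℕ => u n / n) atTop (𝓝 0) := by
  have hC : 0 ≤ C := (abs_nonneg _).trans (h 0)
  have hsqrt : Tendsto Nat.sqrt atTop atTop := by
    refine tendsto_atTop_mono (f := fun n => Nat.sqrt n) (g := Nat.sqrt) (fun _ => le_rfl) ?_
    refine Filter.tendsto_atTop_atTop.2 fun b => ⟨b ^ 2, fun a ha => ?_⟩
    exact Nat.le_sqrt'.2 ha
  have hlim : Tendsto (fun n : ℕ => |u (n ^ 2)| / (n : ℝ) ^ 2 + 2 * C / n) atTop (𝓝 0) := by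
    simpa using hsq.add (tendsto_const_div_atTop_nhds_zero_nat (2 * C))
  refine squeeze_zero_norm' ?_ (hlim.comp hsqrt)
  filter_upwards [eventually_ge_atTop 1] with n hn
  have hs : 1 ≤ n.sqrt := Nat.le_sqrt'.2 (by simpa using hn)
  have hs' : (1 : ℝ) ≤ n.sqrt := by exact_mod_cast hs
  have h1 : n.sqrt ^ 2 ≤ n := Nat.sqrt_le' n
  have h1' : (n.sqrt : ℝ) ^ 2 ≤ n := by exact_mod_cast h1
  -- The gap back to the last square is at most `2 * sqrt n`, so bounded increments cost only
  -- `O(sqrt n)`, negligible against `n`.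
  have h2 : n ≤ n.sqrt ^ 2 + 2 * n.sqrt := by
    have := Nat.sqrt_le_add n
    nlinarith
  obtain ⟨k, hk⟩ := Nat.exists_eq_add_of_le h1
  have hk2 : (k : ℝ) ≤ 2 * n.sqrt := by
    have : k ≤ 2 * n.sqrt := by omega
    exact_mod_cast this
  have h3 : |u n| ≤ |u (n.sqrt ^ 2)| + C * (2 * n.sqrt) := by
    have h4 := abs_sub_le_mul_of_abs_succ_sub_le h (n.sqrt ^ 2) k
    rw [← hk] at h4
    have h5 := abs_sub_abs_le_abs_sub (u n) (u (n.sqrt ^ 2))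
    have h6 : C * k ≤ C * (2 * n.sqrt) := by gcongr
    linarith
  simp only [Function.comp_apply, Real.norm_eq_abs, abs_div, Nat.abs_cast]
  calc |u n| / n ≤ (|u (n.sqrt ^ 2)| + C * (2 * n.sqrt)) / (n.sqrt : ℝ) ^ 2 := by gcongr
    _ = |u (n.sqrt ^ 2)| / (n.sqrt : ℝ) ^ 2 + 2 * C / n.sqrt := by
      have : (n.sqrt : ℝ) ≠ 0 := by positivity
      field_simp

variable {Ω : Type*} [MeasurableSpace Ω] {μ : Measure Ω}

lemma integrable_of_measurable_of_abs_le [IsFiniteMeasure μ] {f : Ω → ℝ} (hf : Measurable f) {C : ℝ}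
    (h : ∀ ω, |f ω| ≤ C) : Integrable f μ :=
  Integrable.of_bound hf.aestronglyMeasurable C (Eventually.of_forall h)

/-- A process with bounded increments whose second moments grow at most linearly is almost surely
`o(n)`. -/
lemma ae_tendsto_div_of_integral_sq_le [IsFiniteMeasure μ] {U : ℕ → Ω → ℝ} {C K : ℝ}
    (hU : ∀ n, Measurable (U n)) (h0 : ∀ ω, U 0 ω = 0)
    (hinc : ∀ n ω, |U (n + 1) ω - U n ω| ≤ C) (hsq : ∀ n : ℕ, ∫ ω, U n ω ^ 2 ∂μ ≤ K * n) :
    ∀ᵐ ω ∂μ, Tendsto (fun n : ℕ => U n ω / n) atTop (𝓝 0) := by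
  have hbd : ∀ n ω, |U n ω| ≤ C * n := fun n ω =>
    abs_le_mul_of_abs_succ_sub_le (u := fun n => U n ω) (h0 ω) (fun n => hinc n ω) n
  have hint : ∀ n, Integrable (fun ω => U n ω ^ 2) μ := fun n =>
    integrable_of_measurable_of_abs_le ((hU n).pow_const 2) (C := (C * n) ^ 2) fun ω => by
      rw [abs_pow]
      exact pow_le_pow_left₀ (abs_nonneg _) (hbd n ω) 2
  have hmeas : ∀ n : ℕ, Measurable fun ω => ENNReal.ofReal (U (n ^ 2) ω ^ 2 / (n : ℝ) ^ 4) :=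
    fun n => (((hU _).pow_const 2).div_const _).ennreal_ofReal
  -- In place of Chebyshev and Borel–Cantelli: along squares the normalized second moments are at
  -- most `K / n ^ 2`, so the series has finite expectation and its terms tend to `0` almost surely.
  have hfin : ∫⁻ ω, ∑' n : ℕ, ENNReal.ofReal (U (n ^ 2) ω ^ 2 / (n : ℝ) ^ 4) ∂μ ≠ ⊤ := by
    rw [lintegral_tsum fun n => (hmeas n).aemeasurable]
    have hle : ∀ n : ℕ, ∫⁻ ω, ENNReal.ofReal (U (n ^ 2) ω ^ 2 / (n : ℝ) ^ 4) ∂μ ≤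
        ENNReal.ofReal (K * (1 / (n : ℝ) ^ 2)) := fun n => by
      rw [← ofReal_integral_eq_lintegral_ofReal ((hint _).div_const _)
        (Eventually.of_forall fun ω => by positivity), integral_div]
      refine ENNReal.ofReal_le_ofReal ?_
      rcases Nat.eq_zero_or_pos n with rfl | hn
      · simp
      have hn' : (n : ℝ) ≠ 0 := by positivity
      have := hsq (n ^ 2)
      push_cast at this
      calc _ ≤ K * (n : ℝ) ^ 2 / (n : ℝ) ^ 4 := by gcongr
        _ = _ := by field_simp
    have hsum : Summable fun n : ℕ => K * (1 / (n : ℝ) ^ 2) :=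
      (Real.summable_one_div_nat_pow.2 one_lt_two).mul_left K
    exact ne_top_of_le_ne_top hsum.tsum_ofReal_ne_top (ENNReal.tsum_le_tsum hle)
  filter_upwards [ae_lt_top (Measurable.tsum hmeas) hfin] with ω hω
  refine tendsto_div_of_tendsto_sq (fun n => hinc n ω) ?_
  have h1 := ENNReal.tendsto_atTop_zero_of_tsum_ne_top hω.ne
  have h2 := (ENNReal.tendsto_toReal ENNReal.zero_ne_top).comp h1
  have h3 := (Real.continuous_sqrt.tendsto _).comp h2
  simp only [ENNReal.toReal_zero, Real.sqrt_zero] at h3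
  refine h3.congr fun n => ?_
  simp only [Function.comp_apply]
  rw [ENNReal.toReal_ofReal (by positivity),
    show U (n ^ 2) ω ^ 2 / (n : ℝ) ^ 4 = (U (n ^ 2) ω / (n : ℝ) ^ 2) ^ 2 by ring,
    Real.sqrt_sq_eq_abs, abs_div, abs_of_nonneg (by positivity : (0 : ℝ) ≤ (n : ℝ) ^ 2)]

/-- If the squared norm of a process with bounded increments has, up to a constant, increments of
nonpositive expectation, then the process is almost surely `o(n)`. -/
lemma ae_tendsto_div_of_sum_sq_succ_le [IsProbabilityMeasure μ] {J : Type*} [Fintype J]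
    {U : J → ℕ → Ω → ℝ} {F : ℕ → Ω → ℝ} {C K : ℝ} (hU : ∀ j n, Measurable (U j n))
    (h0 : ∀ j ω, U j 0 ω = 0) (hinc : ∀ j n ω, |U j (n + 1) ω - U j n ω| ≤ C)
    (hF : ∀ n, Integrable (F n) μ) (hF0 : ∀ n, ∫ ω, F n ω ∂μ ≤ 0)
    (hstep : ∀ n ω, ∑ j, U j (n + 1) ω ^ 2 ≤ ∑ j, U j n ω ^ 2 + F n ω + K) :
    ∀ᵐ ω ∂μ, ∀ j, Tendsto (fun n : ℕ => U j n ω / n) atTop (𝓝 0) := by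
  have hint : ∀ j n, Integrable (fun ω => U j n ω ^ 2) μ := fun j n =>
    integrable_of_measurable_of_abs_le ((hU j n).pow_const 2) (C := (C * n) ^ 2) fun ω => by
      rw [abs_pow]
      exact pow_le_pow_left₀ (abs_nonneg _) (abs_le_mul_of_abs_succ_sub_le
        (u := fun n => U j n ω) (h0 j ω) (fun n => hinc j n ω) n) 2
  have hsum : ∀ n, Integrable (fun ω => ∑ j, U j n ω ^ 2) μ := fun n =>
    integrable_finsetSum _ fun j _ => hint j n
  have hle : ∀ n : ℕ, ∫ ω, ∑ j, U j n ω ^ 2 ∂μ ≤ K * n := fun n => by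
    induction n with
    | zero => simp [h0]
    | succ n ih =>
      have h1 := integral_mono (hsum (n + 1)) (((hsum n).add (hF n)).add (integrable_const K))
        (hstep n)
      have h2 : ∫ ω, ((∑ j, U j n ω ^ 2) + F n ω + K) ∂μ =
          ∫ ω, ∑ j, U j n ω ^ 2 ∂μ + ∫ ω, F n ω ∂μ + K := by
        have h : Integrable (fun ω => ∑ j, U j n ω ^ 2 + F n ω) μ := (hsum n).add (hF n)
        rw [integral_add h (integrable_const K), integral_add (hsum n) (hF n)]
        simp
      have h3 := hF0 n
      push_cast
      simp only [Pi.add_apply] at h1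
      linarith
  rw [ae_all_iff]
  intro j
  refine ae_tendsto_div_of_integral_sq_le (hU j) (h0 j) (hinc j) (K := K) fun n =>
    (integral_mono (hint j n) (hsum n) fun ω => ?_).trans (hle n)
  exact Finset.single_le_sum (f := fun j => U j n ω ^ 2) (fun _ _ => sq_nonneg _)
    (Finset.mem_univ j)

end Convergence

/-! ## Soft thresholding -/

section Soft

/-- The difference between `x` and its projection onto `[-r, r]`. -/
noncomputable def softThreshold (x r : ℝ) : ℝ := max (x - r) 0 - max (-x - r) 0

lemma measurable_softThreshold : Measurable fun p : ℝ × ℝ => softThreshold p.1 p.2 := by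
  unfold softThreshold
  fun_prop

lemma softThreshold_zero_zero : softThreshold 0 0 = 0 := by simp [softThreshold]

/-- Soft thresholding is 1-Lipschitz in the point and in the radius; this bounds the increments of
the excess process. -/
lemma abs_softThreshold_add_sub_le {x r d c : ℝ} (hr : 0 ≤ r) (hc : 0 ≤ c) :
    |softThreshold (x + d) (r + c) - softThreshold x r| ≤ |d| + c := by
  unfold softThreshold
  rw [abs_le]
  rcases abs_cases d with h5 | h5 <;>
  rcases max_cases (x - r) 0 with h1 | h1 <;> rcases max_cases (-x - r) 0 with h2 | h2 <;>
  rcases max_cases (x + d - (r + c)) 0 with h3 | h3 <;>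
  rcases max_cases (-(x + d) - (r + c)) 0 with h4 | h4 <;>
  constructor <;> linarith

/-- The thresholded value is at most as large as any other difference to a point of the
interval. -/
lemma softThreshold_sq_le {x r y : ℝ} (hy : |y| ≤ r) : softThreshold x r ^ 2 ≤ (x - y) ^ 2 := by
  rw [abs_le] at hy
  rw [sq_le_sq]
  unfold softThreshold
  rcases abs_cases (x - y) with h5 | h5 <;>
  rcases max_cases (x - r) 0 with h1 | h1 <;> rcases max_cases (-x - r) 0 with h2 | h2 <;>
  rcases abs_cases (max (x - r) 0 - max (-x - r) 0) with h4 | h4 <;> linarith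

lemma abs_sub_softThreshold_le {x r : ℝ} (hr : 0 ≤ r) : |x - softThreshold x r| ≤ r := by
  unfold softThreshold
  rw [abs_le]
  rcases max_cases (x - r) 0 with h1 | h1 <;> rcases max_cases (-x - r) 0 with h2 | h2 <;>
    constructor <;> linarith

lemma abs_le_add_abs_softThreshold {x r : ℝ} (hr : 0 ≤ r) : |x| ≤ r + |softThreshold x r| := by
  have h1 := abs_add_le (x - softThreshold x r) (softThreshold x r)
  rw [sub_add_cancel] at h1
  linarith [abs_sub_softThreshold_le (x := x) hr]

/-- Blackwell's one-step inequality for an interval that grows with time. The comparison point is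
the old projection, shifted by `c` towards the side on which `x` lies; it stays in the enlarged
interval. Expanding the square leaves the remainder `(d ∓ c) ^ 2 ≤ 4`. -/
lemma softThreshold_add_sq_le {x r d c : ℝ} (hr : 0 ≤ r) (hc : 0 ≤ c) (hd : |d| ≤ 1)
    (hc1 : c ≤ 1) :
    softThreshold (x + d) (r + c) ^ 2 ≤
      softThreshold x r ^ 2 + 2 * (softThreshold x r * d - |softThreshold x r| * c) + 4 := by
  have h1 := abs_sub_softThreshold_le (x := x) hr
  set w := softThreshold x r
  rw [abs_le] at hd h1
  rcases abs_cases w with hw | hw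
  · have h2 := softThreshold_sq_le (x := x + d) (r := r + c) (y := x - w + c)
      (abs_le.2 ⟨by linarith, by linarith⟩)
    rw [hw.1]
    nlinarith
  · have h2 := softThreshold_sq_le (x := x + d) (r := r + c) (y := x - w - c)
      (abs_le.2 ⟨by linarith, by linarith⟩)
    rw [hw.1]
    nlinarith

end Soft

/-! ## A mixed action that calibrates -/

section Mixture

lemma gridPoint_pos {N : ℕ} (k : Fin N) : 0 < gridPoint N k := by
  have : 0 < N := k.pos
  unfold gridPoint
  positivity

lemma gridPoint_lt_one {N : ℕ} (k : Fin N) : gridPoint N k < 1 := by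
  have : (0 : ℝ) < N := by exact_mod_cast k.pos
  have h : (k : ℝ) + 1 ≤ N := by exact_mod_cast k.isLt
  rw [gridPoint, div_lt_one this]
  linarith

lemma gridPoint_succ {M : ℕ} (j : Fin M) :
    gridPoint (M + 1) j.succ = gridPoint (M + 1) j.castSucc + 2 * (1 / (2 * ((M + 1 : ℕ) : ℝ))) := by
  unfold gridPoint
  push_cast [Fin.val_succ, Fin.val_castSucc]
  have : (M : ℝ) + 1 ≠ 0 := by positivity
  field_simp
  ring

lemma outcome_nonneg (b : Fin 2) : 0 ≤ outcome b := by simp [outcome]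

lemma outcome_le_one (b : Fin 2) : outcome b ≤ 1 := by
  unfold outcome
  exact_mod_cast Nat.le_of_lt_succ b.isLt

lemma abs_gridPoint_sub_outcome_le {N : ℕ} (k : Fin N) (b : Fin 2) :
    |gridPoint N k - outcome b| ≤ 1 := by
  rw [abs_le]
  constructor <;> linarith [gridPoint_pos k, gridPoint_lt_one k, outcome_nonneg b, outcome_le_one b]

/-- The grid lies strictly inside `(0, 1)`. Hence payoffs alone reveal which grid point was used. -/
lemma gridPoint_sub_outcome_ne_zero {N : ℕ} (k : Fin N) (b : Fin 2) :
    gridPoint N k - outcome b ≠ 0 := by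
  have h0 := gridPoint_pos k
  have h1 := gridPoint_lt_one k
  fin_cases b
  · simpa [outcome] using h0.ne'
  · simpa [outcome, sub_eq_zero] using h1.ne

/-- For the weights `w` of the grid points, the excess of the weighted calibration payoff over the
tolerance `1 / (2N)`. -/
noncomputable def weightedExcess {N : ℕ} (w : Fin N → ℝ) (k : Fin N) (b : Fin 2) : ℝ :=
  w k * (gridPoint N k - outcome b) - |w k| * (1 / (2 * (N : ℝ)))

/-- If the lowest weight is nonnegative, the lowest grid point works, as it exceeds `0` by just the
tolerance; if the highest weight is negative, the highest one works symmetrically. Otherwise the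
sign changes between two neighbours, and a mixture cancels the dependence on `b`. Fixing the sign
pattern fixes the support of the mixture, so measurability in `w` is clear. -/
lemma exists_mixture_of_pattern {M : ℕ} (ε : Fin (M + 1) → Prop) :
    ∃ p : (Fin (M + 1) → ℝ) → Fin (M + 1) → ℝ, Measurable p ∧ (∀ w k, 0 ≤ p w k) ∧
      (∀ w, ∑ k, p w k = 1) ∧
      ∀ w, (∀ k, ε k ↔ 0 ≤ w k) → ∀ b, ∑ k, p w k * weightedExcess w k b ≤ 0 := by
  classical
  by_cases h0 : ε 0
  · refine ⟨fun _ k => if k = 0 then 1 else 0, measurable_const, fun _ k => ?_, fun _ => ?_,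
      fun w hw b => ?_⟩
    · dsimp only
      split_ifs <;> norm_num
    · simp
    · have hw0 : 0 ≤ w 0 := (hw 0).1 h0
      have hb := outcome_nonneg b
      simp only [ite_mul, one_mul, zero_mul, Finset.sum_ite_eq', Finset.mem_univ, if_true,
        weightedExcess, abs_of_nonneg hw0]
      have : gridPoint (M + 1) 0 = 1 / (2 * ((M + 1 : ℕ) : ℝ)) := by
        simp only [gridPoint, Fin.val_zero]
        field_simp
        simp
      rw [this]
      nlinarith
  by_cases h1 : ε (Fin.last M)
  -- Discrete intermediate value: the pattern fails at the bottom and holds at the top.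
  · obtain ⟨j, hj, hj'⟩ : ∃ j : Fin M, ¬ ε j.castSucc ∧ ε j.succ := by
      by_contra! h
      exact Fin.induction (motive := fun k => ¬ ε k) h0 h (Fin.last M) h1
    have hne : j.succ ≠ j.castSucc := (Fin.castSucc_lt_succ).ne'
    -- `θ` solves `θ * w j.castSucc + (1 - θ) * w j.succ = 0` under the pattern. The positive parts
    -- keep it in `[0, 1]` for every other `w`.
    set θ : (Fin (M + 1) → ℝ) → ℝ := fun w =>
      max (w j.succ) 0 / (max (w j.succ) 0 + max (-w j.castSucc) 0) with hθ
    have hθ0 : ∀ w, 0 ≤ θ w := fun w => by positivity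
    have hθ1 : ∀ w, θ w ≤ 1 := fun w =>
      div_le_one_of_le₀ (by linarith [le_max_right (-w j.castSucc) 0]) (by positivity)
    have hmeas : Measurable θ := by fun_prop
    refine ⟨fun w k => if k = j.castSucc then θ w else if k = j.succ then 1 - θ w else 0,
      measurable_pi_lambda _ fun k => ?_, fun w k => ?_, fun w => ?_, fun w hw b => ?_⟩
    · split_ifs <;> fun_prop
    · dsimp only
      split_ifs
      exacts [hθ0 w, sub_nonneg.2 (hθ1 w), le_rfl]
    · rw [← Finset.add_sum_erase _ _ (Finset.mem_univ j.castSucc),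
        Finset.sum_eq_single_of_mem j.succ (by simp [hne])]
      · simp [hne]
      · intro k hk hk'
        simp [Finset.ne_of_mem_erase hk, hk']
    · rw [← Finset.add_sum_erase _ _ (Finset.mem_univ j.castSucc),
        Finset.sum_eq_single_of_mem j.succ (by simp [hne])]
      · have hx : w j.castSucc < 0 := not_le.1 fun h => hj ((hw _).2 h)
        have hy : 0 ≤ w j.succ := (hw _).1 hj'
        simp only [if_true, if_neg hne, weightedExcess, gridPoint_succ, abs_of_nonneg hy,
          abs_of_neg hx, hθ, max_eq_left hy, max_eq_left (neg_nonneg.2 hx.le)]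
        have hd : w j.succ + -w j.castSucc ≠ 0 := by linarith
        -- Equality holds: the spacing `2c` of the two grid points pays exactly for their two
        -- tolerances `c`.
        apply le_of_eq
        generalize 1 / (2 * ((M + 1 : ℕ) : ℝ)) = c
        field_simp
        ring
      · intro k hk hk'
        simp [Finset.ne_of_mem_erase hk, hk']
  · refine ⟨fun _ k => if k = Fin.last M then 1 else 0, measurable_const, fun _ k => ?_,
      fun _ => ?_, fun w hw b => ?_⟩
    · dsimp only
      split_ifs <;> norm_num
    · simp
    · have hw0 : w (Fin.last M) < 0 := not_le.1 fun h => h1 ((hw _).2 h)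
      have hb := outcome_le_one b
      simp only [ite_mul, one_mul, zero_mul, Finset.sum_ite_eq', Finset.mem_univ, if_true,
        weightedExcess, abs_of_neg hw0]
      have : gridPoint (M + 1) (Fin.last M) = 1 - 1 / (2 * ((M + 1 : ℕ) : ℝ)) := by
        simp only [gridPoint, Fin.val_last]
        push_cast
        have : (M : ℝ) + 1 ≠ 0 := by positivity
        field_simp
        ring
      rw [this]
      nlinarith

/-- There are finitely many sign patterns, so choosing the mixture according to the signs of `w`
stays measurable. -/
lemma exists_mixture {N : ℕ} (hN : 0 < N) :
    ∃ p : (Fin N → ℝ) → Fin N → ℝ, Measurable p ∧ (∀ w k, 0 ≤ p w k) ∧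
      (∀ w, ∑ k, p w k = 1) ∧ ∀ w b, ∑ k, p w k * weightedExcess w k b ≤ 0 := by
  obtain ⟨M, rfl⟩ := Nat.exists_eq_succ_of_ne_zero hN.ne'
  choose p hp hp0 hp1 hp2 using fun ε : Fin (M + 1) → Prop => exists_mixture_of_pattern ε
  let sgn : (Fin (M + 1) → ℝ) → Fin (M + 1) → Prop := fun w k => 0 ≤ w k
  have hsgn : Measurable sgn := measurable_pi_lambda _ fun k =>
    measurableSet_setOfPred.1 (measurableSet_le measurable_const (measurable_pi_apply k))
  refine ⟨fun w => p (sgn w) w, ?_, fun w => hp0 _ w, fun w => hp1 _ w,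
    fun w b => hp2 _ w (fun k => Iff.rfl) b⟩
  have h : Measurable fun q : (Fin (M + 1) → Prop) × (Fin (M + 1) → ℝ) => p q.1 q.2 :=
    measurable_from_prod_countable_right fun ε => hp ε
  exact h.comp (hsgn.prodMk measurable_id)

/-- A measurable choice of mixed actions for which the expected excess is nonpositive, whatever the
outcome. -/
lemma exists_kernel_integral_weightedExcess_nonpos {N : ℕ} (hN : 0 < N) :
    ∃ κ : Kernel (Fin N → ℝ) (Fin N), IsMarkovKernel κ ∧
      ∀ w b, ∫ k, weightedExcess w k b ∂(κ w) ≤ 0 := by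
  obtain ⟨p, hp, hp0, hp1, hp2⟩ := exists_mixture hN
  refine ⟨⟨fun w => ∑ k, ENNReal.ofReal (p w k) • Measure.dirac k, ?_⟩, ⟨fun w => ⟨?_⟩⟩,
    fun w b => ?_⟩
  · refine Measure.measurable_of_measurable_coe _ fun s _ => ?_
    simp only [Measure.coe_finsetSum, Finset.sum_apply, Measure.smul_apply, smul_eq_mul]
    exact Finset.measurable_sum _ fun k _ =>
      (((measurable_pi_apply k).comp hp).ennreal_ofReal).mul_const _
  · simp only [Kernel.coe_mk, Measure.coe_finsetSum, Finset.sum_apply, Measure.smul_apply,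
      measure_univ, smul_eq_mul, mul_one]
    rw [← ENNReal.ofReal_sum_of_nonneg fun k _ => hp0 w k, hp1, ENNReal.ofReal_one]
  · simp only [Kernel.coe_mk]
    rw [integral_finsetSum_measure fun k _ =>
      (integrable_dirac (by simp)).smul_measure ENNReal.ofReal_ne_top]
    simpa [integral_smul_measure, ENNReal.toReal_ofReal, hp0] using hp2 w b

end Mixture

/-! ## One-step expectations under the law of the game -/

section Law

variable {X S A B Γ ι : Type*} [Fintype ι] [MeasurableSpace X] [MeasurableSpace S]
  [MeasurableSpace A] [MeasurableSpace B] [MeasurableSpace Γ]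

instance (Q : Measure (X × S)) [IsProbabilityMeasure Q] (m : Payoff X S A B ι)
    (G : X × S → Γ) (hG : Measurable G) (σ : PlayerStrategy X S A ι)
    (τ : NatureStrategy X S A B Γ) : IsProbabilityMeasure (playLaw Q m G hG σ τ) := by
  unfold playLaw
  infer_instance

/-- The Player's draw is innermost, with outcome and contexts frozen, and the contexts are
outermost. Calibration uses the former, parity the latter. -/
lemma integral_roundKernel (Q : Measure (X × S)) [IsProbabilityMeasure Q] (m : Payoff X S A B ι)
    (G : X × S → Γ) (hG : Measurable G) (σ : PlayerStrategy X S A ι)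
    (τ : NatureStrategy X S A B Γ) (n : ℕ) (h : Fin n → Round X S A B)
    {f : Round X S A B → ℝ} (hf : Measurable f) {C : ℝ} (hC : ∀ r, |f r| ≤ C) :
    ∫ r, f r ∂(roundKernel Q m G hG σ τ n h) =
      ∫ z, ∫ b, ∫ a, f (z, (a, b)) ∂(σ.act n (fun i => m.obs (h i), z.1))
        ∂(τ.act n (h, G z)) ∂Q := by
  have := σ.isMarkov n
  have := τ.isMarkov n
  have hint := integrable_of_measurable_of_abs_le (μ := roundKernel Q m G hG σ τ n h) hf hC
  unfold roundKernel at hint ⊢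
  rw [ProbabilityTheory.integral_compProd hint]
  simp only [Kernel.const_apply]
  congr 1
  funext z
  rw [Kernel.prod_apply, integral_prod_symm]
  · simp only [Kernel.comap_apply]
  · exact integrable_of_measurable_of_abs_le (hf.comp measurable_prodMk_left) fun y => hC _

/-- A function of the past and of the next round with nonpositive conditional expectations has a
nonpositive expectation. -/
lemma integral_playLaw_nonpos (Q : Measure (X × S)) [IsProbabilityMeasure Q]
    (m : Payoff X S A B ι) (G : X × S → Γ) (hG : Measurable G) (σ : PlayerStrategy X S A ι)
    (τ : NatureStrategy X S A B Γ) (n : ℕ)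
    {f : (Fin (n + 1) → Round X S A B) → Round X S A B → ℝ}
    (hf : Measurable (Function.uncurry f)) {C : ℝ} (hC : ∀ h r, |f h r| ≤ C)
    (h0 : ∀ h, ∫ r, f h r ∂(roundKernel Q m G hG σ τ (n + 1) h) ≤ 0) :
    ∫ ω, f (fun i => ω i) (ω (n + 1)) ∂(playLaw Q m G hG σ τ) ≤ 0 := by
  let φ : ((i : Finset.Iic n) → Round X S A B) → Fin (n + 1) → Round X S A B :=
    fun h i => h ⟨i, Finset.mem_Iic.2 (Nat.lt_succ_iff.1 i.isLt)⟩
  have hφ : Measurable φ := measurable_pi_lambda _ fun _ => measurable_pi_apply _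
  let g : ((i : Finset.Iic n) → Round X S A B) × Round X S A B → ℝ := fun y => f (φ y.1) y.2
  have hg : Measurable g := hf.comp ((hφ.comp measurable_fst).prodMk measurable_snd)
  have key := Kernel.map_frestrictLe_trajMeasure_compProd_eq_map_trajMeasure
    (X := fun _ => Round X S A B) (μ₀ := roundKernel Q m G hG σ τ 0 Fin.elim0)
    (κ := fun n => (roundKernel Q m G hG σ τ (n + 1)).comap
      (fun (h : (i : Finset.Iic n) → Round X S A B) (i : Fin (n + 1)) =>
        h ⟨i, Finset.mem_Iic.2 (Nat.lt_succ_iff.1 i.isLt)⟩)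
      (measurable_pi_lambda _ fun _ => measurable_pi_apply _)) (a := n)
  have h1 : ∫ ω, f (fun i => ω i) (ω (n + 1)) ∂(playLaw Q m G hG σ τ) =
      ∫ y, g y ∂((playLaw Q m G hG σ τ).map
        fun ω => (Preorder.frestrictLe (π := fun _ => Round X S A B) n ω, ω (n + 1))) := by
    rw [integral_map (by fun_prop) hg.aestronglyMeasurable]
    rfl
  rw [h1, playLaw, ← key, Measure.integral_compProd]
  · exact integral_nonpos fun h => h0 (φ h)
  · exact integrable_of_measurable_of_abs_le hg fun y => hC _ _

end Law

/-! ## The calibration strategy -/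

section Strategy

set_option linter.unusedSectionVars false

variable {X : Type*} [MeasurableSpace X] {N : ℕ}

/-- The cumulated calibration errors of the grid points, thresholded at `1 / (2N)` times their
numbers of uses, as functions of the observations of the Player. A grid point has been used in a
round exactly if its calibration payoff is nonzero. -/
noncomputable def obsExcess {n : ℕ} (h : Fin n → PlayerObs X (Fin 2) (Fin N ⊕ Fin 2)) (k : Fin N) :
    ℝ :=
  softThreshold (∑ i, (h i).1 (Sum.inl k))
    (∑ i, if (h i).1 (Sum.inl k) = 0 then 0 else 1 / (2 * (N : ℝ)))

lemma measurable_obsExcess (n : ℕ) :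
    Measurable (obsExcess : (Fin n → PlayerObs X (Fin 2) (Fin N ⊕ Fin 2)) → Fin N → ℝ) := by
  refine measurable_pi_lambda _ fun k => ?_
  have h : ∀ i : Fin n, Measurable fun h : Fin n → PlayerObs X (Fin 2) (Fin N ⊕ Fin 2) =>
      (h i).1 (Sum.inl k) := fun i =>
    ((EuclideanSpace.proj (𝕜 := ℝ) (Sum.inl k : Fin N ⊕ Fin 2)).continuous.measurable.comp
      measurable_fst).comp (measurable_pi_apply i)
  exact measurable_softThreshold.comp
    ((Finset.measurable_sum Finset.univ fun i _ => h i).prodMk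
      (Finset.measurable_sum Finset.univ fun i _ => Measurable.ite
        (p := fun h : Fin n → PlayerObs X (Fin 2) (Fin N ⊕ Fin 2) => (h i).1 (Sum.inl k) = 0)
        ((h i) (measurableSet_singleton 0)) measurable_const measurable_const))

/-- The strategy that ignores the contexts and plays according to the thresholded calibration
errors. -/
noncomputable def calStrategy (X : Type*) [MeasurableSpace X] (κ : Kernel (Fin N → ℝ) (Fin N))
    [IsMarkovKernel κ] : PlayerStrategy X (Fin 2) (Fin N) (Fin N ⊕ Fin 2) where
  act n := κ.comap (fun p => obsExcess p.1) ((measurable_obsExcess n).comp measurable_fst)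
  isMarkov _ := inferInstance

lemma calStrategy_act_apply (κ : Kernel (Fin N → ℝ) (Fin N)) [IsMarkovKernel κ] (n : ℕ)
    (p : (Fin n → PlayerObs X (Fin 2) (Fin N ⊕ Fin 2)) × X) :
    (calStrategy X κ).act n p = κ (obsExcess p.1) :=
  rfl

/-- The cumulated calibration error of the grid point `k`. -/
noncomputable def calSum (k : Fin N) (T : ℕ) (ω : ℕ → Round X (Fin 2) (Fin N) (Fin 2)) : ℝ :=
  ∑ t ∈ Finset.range T, if (ω t).2.1 = k then gridPoint N k - outcome (ω t).2.2 else 0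

/-- The tolerance `1 / (2N)` times the number of uses of the grid point `k`. -/
noncomputable def calTol (k : Fin N) (T : ℕ) (ω : ℕ → Round X (Fin 2) (Fin N) (Fin 2)) : ℝ :=
  ∑ t ∈ Finset.range T, if (ω t).2.1 = k then 1 / (2 * (N : ℝ)) else 0

/-- The part of the cumulated calibration error of `k` that exceeds the tolerance. -/
noncomputable def calExcess (k : Fin N) (T : ℕ) (ω : ℕ → Round X (Fin 2) (Fin N) (Fin 2)) : ℝ :=
  softThreshold (calSum k T ω) (calTol k T ω)

lemma calDpPayoff_inl (Q : Measure (X × Fin 2)) (k : Fin N) (b : Fin 2) (x : X) (s : Fin 2)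
    (k' : Fin N) : (calDpPayoff Q N).toFun k b x s (Sum.inl k') =
      if k = k' then gridPoint N k' - outcome b else 0 := by
  simp [calDpPayoff, calPayoff, eq_comm]

lemma calDpPayoff_inr (Q : Measure (X × Fin 2)) (k : Fin N) (b : Fin 2) (x : X) (s s' : Fin 2) :
    (calDpPayoff Q N).toFun k b x s (Sum.inr s') =
      if s = s' then gridPoint N k / groupProb Q s' else 0 := by
  simp [calDpPayoff, dpPayoff]

/-- The Player can compute the quantity that the analysis tracks: a zero payoff coordinate means an
unused grid point. -/
lemma obsExcess_obs (Q : Measure (X × Fin 2)) (n : ℕ)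
    (ω : ℕ → Round X (Fin 2) (Fin N) (Fin 2)) :
    obsExcess (fun i : Fin n => (calDpPayoff Q N).obs (ω i)) = fun k => calExcess k n ω := by
  funext k
  simp only [obsExcess, calExcess, calSum, calTol, Payoff.obs, calDpPayoff_inl, Finset.sum_range]
  congr 1
  refine Finset.sum_congr rfl fun i _ => ?_
  by_cases h : (ω i).2.1 = k <;> simp [h, gridPoint_sub_outcome_ne_zero]

lemma calTol_nonneg (k : Fin N) (T : ℕ) (ω : ℕ → Round X (Fin 2) (Fin N) (Fin 2)) :
    0 ≤ calTol k T ω :=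
  Finset.sum_nonneg fun t _ => by split_ifs <;> positivity

/-- Each round uses exactly one grid point, so the total budget does not depend on the play. -/
lemma sum_calTol (T : ℕ) (ω : ℕ → Round X (Fin 2) (Fin N) (Fin 2)) :
    ∑ k, calTol k T ω = T * (1 / (2 * (N : ℝ))) := by
  unfold calTol
  rw [Finset.sum_comm]
  simp

lemma one_div_two_mul_le_one (N : ℕ) : 1 / (2 * (N : ℝ)) ≤ 1 := by
  rcases Nat.eq_zero_or_pos N with rfl | hN
  · simp
  · have : (1 : ℝ) ≤ N := by exact_mod_cast hN
    rw [div_le_one (by positivity)]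
    linarith

lemma measurable_calExcess (k : Fin N) (T : ℕ) :
    Measurable (calExcess k T : (ℕ → Round X (Fin 2) (Fin N) (Fin 2)) → ℝ) := by
  have h : ∀ (t : ℕ) (f : Fin N × Fin 2 → ℝ),
      Measurable fun ω : ℕ → Round X (Fin 2) (Fin N) (Fin 2) => f (ω t).2 := fun t f =>
    (measurable_of_countable f).comp (measurable_snd.comp (measurable_pi_apply t))
  exact measurable_softThreshold.comp (Measurable.prodMk
    (Finset.measurable_sum (Finset.range T) fun t _ =>
      h t fun y => if y.1 = k then gridPoint N k - outcome y.2 else 0)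
    (Finset.measurable_sum (Finset.range T) fun t _ =>
      h t fun y => if y.1 = k then 1 / (2 * (N : ℝ)) else 0))

lemma abs_calExcess_succ_sub_le (k : Fin N) (T : ℕ) (ω : ℕ → Round X (Fin 2) (Fin N) (Fin 2)) :
    |calExcess k (T + 1) ω - calExcess k T ω| ≤ 2 := by
  simp only [calExcess, calSum, calTol, Finset.sum_range_succ]
  refine (abs_softThreshold_add_sub_le (calTol_nonneg k T ω) ?_).trans ?_
  · split_ifs <;> positivity
  · split_ifs
    · linarith [abs_gridPoint_sub_outcome_le k (ω T).2.2, one_div_two_mul_le_one N]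
    · simp

lemma calExcess_zero (k : Fin N) (ω : ℕ → Round X (Fin 2) (Fin N) (Fin 2)) :
    calExcess k 0 ω = 0 := by
  simp [calExcess, calSum, calTol, softThreshold_zero_zero]

/-- Only the coordinate of the grid point just used changes, so `softThreshold_add_sq_le` is paid
once. -/
lemma sum_calExcess_sq_succ_le (T : ℕ) (ω : ℕ → Round X (Fin 2) (Fin N) (Fin 2)) :
    ∑ k, calExcess k (T + 1) ω ^ 2 ≤ ∑ k, calExcess k T ω ^ 2 +
      2 * weightedExcess (fun k => calExcess k T ω) (ω T).2.1 (ω T).2.2 + 4 := by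
  have h : ∀ k, calExcess k (T + 1) ω ^ 2 ≤ calExcess k T ω ^ 2 + if (ω T).2.1 = k then
      2 * weightedExcess (fun k => calExcess k T ω) k (ω T).2.2 + 4 else 0 := fun k => by
    have hk : calExcess k (T + 1) ω = softThreshold
        (calSum k T ω + if (ω T).2.1 = k then gridPoint N k - outcome (ω T).2.2 else 0)
        (calTol k T ω + if (ω T).2.1 = k then 1 / (2 * (N : ℝ)) else 0) := by
      simp only [calExcess, calSum, calTol, Finset.sum_range_succ]
    rw [hk]
    split_ifs with h
    · have := softThreshold_add_sq_le (x := calSum k T ω) (calTol_nonneg k T ω)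
        (by positivity : 0 ≤ 1 / (2 * (N : ℝ))) (abs_gridPoint_sub_outcome_le k (ω T).2.2)
        (one_div_two_mul_le_one N)
      simpa [weightedExcess, calExcess, add_assoc] using this
    · simp [calExcess]
  refine (Finset.sum_le_sum fun k _ => h k).trans (le_of_eq ?_)
  rw [Finset.sum_add_distrib, Finset.sum_ite_eq]
  simp [add_assoc]

lemma abs_weightedExcess_le {w : Fin N → ℝ} {C : ℝ} (hw : ∀ k, |w k| ≤ C) (k : Fin N)
    (b : Fin 2) : |weightedExcess w k b| ≤ 2 * C := by
  have h1 := abs_gridPoint_sub_outcome_le k b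
  have h2 := one_div_two_mul_le_one N
  have h3 : 0 ≤ 1 / (2 * (N : ℝ)) := by positivity
  have h4 := abs_nonneg (w k)
  unfold weightedExcess
  calc _ ≤ |w k * (gridPoint N k - outcome b)| + |(|w k| * (1 / (2 * (N : ℝ))))| := abs_sub _ _
    _ = |w k| * |gridPoint N k - outcome b| + |w k| * (1 / (2 * (N : ℝ))) := by
      rw [abs_mul, abs_mul, abs_abs, abs_of_nonneg h3]
    _ ≤ |w k| * 1 + |w k| * 1 := by gcongr
    _ ≤ 2 * C := by linarith [hw k]

lemma measurable_weightedExcess :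
    Measurable fun y : (Fin N → ℝ) × (Fin N × Fin 2) => weightedExcess y.1 y.2.1 y.2.2 := by
  refine measurable_from_prod_countable_left fun y => ?_
  simp only [weightedExcess]
  have h : Measurable fun w : Fin N → ℝ => w y.1 := measurable_pi_apply y.1
  exact Measurable.sub (h.mul_const _) (h.abs.mul_const _)

variable {Γ : Type*} [MeasurableSpace Γ]

lemma abs_calExcess_le (k : Fin N) (n : ℕ) (ω : ℕ → Round X (Fin 2) (Fin N) (Fin 2)) :
    |calExcess k n ω| ≤ 2 * n :=
  abs_le_mul_of_abs_succ_sub_le (u := fun n => calExcess k n ω) (calExcess_zero k ω)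
    (fun n => abs_calExcess_succ_sub_le k n ω) n

/-- The excess depends only on the past, so `hκ` applies conditionally on the past and on Nature's
outcome. -/
lemma integral_weightedExcess_calExcess_nonpos (κ : Kernel (Fin N → ℝ) (Fin N)) [IsMarkovKernel κ]
    (hκ : ∀ w b, ∫ k, weightedExcess w k b ∂(κ w) ≤ 0)
    (Q : Measure (X × Fin 2)) [IsProbabilityMeasure Q] (G : X × Fin 2 → Γ) (hG : Measurable G)
    (τ : NatureStrategy X (Fin 2) (Fin N) (Fin 2) Γ) (n : ℕ) :
    ∫ ω, weightedExcess (fun k => calExcess k n ω) (ω n).2.1 (ω n).2.2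
      ∂(playLaw Q (calDpPayoff Q N) G hG (calStrategy X κ) τ) ≤ 0 := by
  cases n with
  -- The first round has its own initial law; the integrand vanishes there, as nothing has
  -- cumulated.
  | zero => simp [calExcess_zero, weightedExcess]
  | succ n =>
    let m := calDpPayoff Q N
    let f : (Fin (n + 1) → Round X (Fin 2) (Fin N) (Fin 2)) →
        Round X (Fin 2) (Fin N) (Fin 2) → ℝ := fun h r =>
      weightedExcess (obsExcess fun i => m.obs (h i)) r.2.1 r.2.2
    have hobs : Measurable fun h : Fin (n + 1) → Round X (Fin 2) (Fin N) (Fin 2) =>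
        (obsExcess fun i => m.obs (h i)) :=
      (measurable_obsExcess _).comp (measurable_pi_lambda _ fun i =>
        m.measurable_obs.comp (measurable_pi_apply i))
    have hf : Measurable (Function.uncurry f) := measurable_weightedExcess.comp
      ((hobs.comp measurable_fst).prodMk (measurable_snd.comp measurable_snd))
    have hC : ∀ h r, |f h r| ≤ 2 * (2 * (n + 1 : ℕ)) := fun h r => by
      refine abs_weightedExcess_le (fun k => ?_) _ _
      -- The finite history is extended periodically to an infinite one, only to reuse the bound on
      -- `calExcess`.
      have h1 := obsExcess_obs Q (n + 1) (fun t => h (Fin.ofNat (n + 1) t))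
      simp only [Fin.ofNat_eq_cast, Fin.cast_val_eq_self] at h1
      rw [h1]
      exact abs_calExcess_le _ _ _
    have h0 : ∀ h, ∫ r, f h r ∂(roundKernel Q m G hG (calStrategy X κ) τ (n + 1) h) ≤ 0 :=
        fun h => by
      have hfh : Measurable (f h) := hf.of_uncurry_left
      rw [integral_roundKernel Q m G hG (calStrategy X κ) τ (n + 1) h hfh (hC h)]
      refine integral_nonpos fun z => integral_nonpos fun b => ?_
      rw [calStrategy_act_apply]
      exact hκ (obsExcess fun i => m.obs (h i)) b
    have key := integral_playLaw_nonpos Q m G hG (calStrategy X κ) τ n hf hC h0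
    simpa only [f, m, obsExcess_obs Q (n + 1)] using key

lemma ae_tendsto_calExcess_div (κ : Kernel (Fin N → ℝ) (Fin N)) [IsMarkovKernel κ]
    (hκ : ∀ w b, ∫ k, weightedExcess w k b ∂(κ w) ≤ 0)
    (Q : Measure (X × Fin 2)) [IsProbabilityMeasure Q] (G : X × Fin 2 → Γ) (hG : Measurable G)
    (τ : NatureStrategy X (Fin 2) (Fin N) (Fin 2) Γ) :
    ∀ᵐ ω ∂(playLaw Q (calDpPayoff Q N) G hG (calStrategy X κ) τ),
      ∀ k : Fin N, Tendsto (fun T : ℕ => calExcess k T ω / T) atTop (𝓝 0) := by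
  refine ae_tendsto_div_of_sum_sq_succ_le (C := 2) (K := 4)
    (F := fun n ω => 2 * weightedExcess (fun k => calExcess k n ω) (ω n).2.1 (ω n).2.2)
    measurable_calExcess calExcess_zero abs_calExcess_succ_sub_le (fun n => ?_) (fun n => ?_)
    sum_calExcess_sq_succ_le
  · refine Integrable.const_mul (integrable_of_measurable_of_abs_le
      (measurable_weightedExcess.comp
        ((measurable_pi_lambda _ fun k => measurable_calExcess k n).prodMk
          (measurable_snd.comp (measurable_pi_apply n)))) fun ω =>
        abs_weightedExcess_le (fun k => abs_calExcess_le k n ω) _ _) _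
  · rw [integral_const_mul]
    exact mul_nonpos_of_nonneg_of_nonpos zero_le_two
      (integral_weightedExcess_calExcess_nonpos κ hκ Q G hG τ n)

/-! ## Demographic parity -/

lemma integral_ite_snd_eq (Q : Measure (X × Fin 2)) [IsProbabilityMeasure Q] (s : Fin 2) (c : ℝ) :
    ∫ z, (if z.2 = s then c else 0) ∂Q = groupProb Q s * c := by
  have hs : MeasurableSet {z : X × Fin 2 | z.2 = s} := measurable_snd (measurableSet_singleton s)
  have := integral_indicator_const (μ := Q) c hs
  simpa [Set.indicator_apply, groupProb] using this

/-- The signed weight of the group `s` in the demographic parity gap. -/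
noncomputable def groupWeight (Q : Measure (X × Fin 2)) (s : Fin 2) : ℝ :=
  (if s = 0 then 1 / groupProb Q 0 else 0) - if s = 1 then 1 / groupProb Q 1 else 0

lemma exists_abs_groupWeight_le (Q : Measure (X × Fin 2)) : ∃ C, ∀ s, |groupWeight Q s| ≤ C := by
  obtain ⟨C, hC⟩ := (Set.finite_range fun s => |groupWeight Q s|).bddAbove
  exact ⟨C, fun s => hC ⟨s, rfl⟩⟩

lemma integral_groupWeight (Q : Measure (X × Fin 2)) [IsProbabilityMeasure Q]
    (hQ : ∀ s, 0 < groupProb Q s) : ∫ z, groupWeight Q z.2 ∂Q = 0 := by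
  have hint : ∀ (s : Fin 2) (c : ℝ), Integrable (fun z : X × Fin 2 => if z.2 = s then c else 0) Q :=
    fun s c => integrable_of_measurable_of_abs_le (C := |c|)
      ((measurable_of_countable fun s' : Fin 2 => if s' = s then c else 0).comp measurable_snd)
      fun z => by split_ifs <;> simp
  unfold groupWeight
  rw [integral_sub (hint _ _) (hint _ _), integral_ite_snd_eq, integral_ite_snd_eq,
    mul_one_div_cancel (hQ 0).ne', mul_one_div_cancel (hQ 1).ne', sub_self]

/-- The cumulated signed demographic parity gap. -/
noncomputable def dpSum (Q : Measure (X × Fin 2)) (T : ℕ)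
    (ω : ℕ → Round X (Fin 2) (Fin N) (Fin 2)) : ℝ :=
  ∑ t ∈ Finset.range T, gridPoint N (ω t).2.1 * groupWeight Q (ω t).1.2

lemma abs_gridPoint_mul_le {c C : ℝ} (h : |c| ≤ C) (k : Fin N) : |gridPoint N k * c| ≤ C := by
  rw [abs_mul, abs_of_pos (gridPoint_pos k)]
  calc _ ≤ 1 * |c| := by gcongr; exact (gridPoint_lt_one k).le
    _ ≤ C := by simpa using h

lemma measurable_gridPoint_mul_groupWeight (Q : Measure (X × Fin 2)) :
    Measurable fun r : Round X (Fin 2) (Fin N) (Fin 2) =>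
      gridPoint N r.2.1 * groupWeight Q r.1.2 :=
  (measurable_of_countable fun y : Fin 2 × Fin N => gridPoint N y.2 * groupWeight Q y.1).comp
    ((measurable_snd.comp measurable_fst).prodMk (measurable_fst.comp measurable_snd))

/-- Given the past, the forecast has the same law for all contexts, so the mean of the new term
factors and `integral_groupWeight` kills it. -/
lemma integral_dpSum_mul_nonpos (κ : Kernel (Fin N → ℝ) (Fin N)) [IsMarkovKernel κ]
    (Q : Measure (X × Fin 2)) [IsProbabilityMeasure Q] (hQ : ∀ s, 0 < groupProb Q s)
    (G : X × Fin 2 → Γ) (hG : Measurable G)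
    (τ : NatureStrategy X (Fin 2) (Fin N) (Fin 2) Γ) (n : ℕ) :
    ∫ ω, dpSum Q n ω * (gridPoint N (ω n).2.1 * groupWeight Q (ω n).1.2)
      ∂(playLaw Q (calDpPayoff Q N) G hG (calStrategy X κ) τ) ≤ 0 := by
  cases n with
  | zero => simp [dpSum]
  | succ n =>
    obtain ⟨C, hC⟩ := exists_abs_groupWeight_le Q
    have hC0 : 0 ≤ C := (abs_nonneg _).trans (hC 0)
    let f : (Fin (n + 1) → Round X (Fin 2) (Fin N) (Fin 2)) →
        Round X (Fin 2) (Fin N) (Fin 2) → ℝ := fun h r =>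
      (∑ i, gridPoint N (h i).2.1 * groupWeight Q (h i).1.2) *
        (gridPoint N r.2.1 * groupWeight Q r.1.2)
    have hf : Measurable (Function.uncurry f) := by
      refine Measurable.mul (Finset.measurable_sum _ fun i _ => ?_)
        ((measurable_gridPoint_mul_groupWeight Q).comp measurable_snd)
      exact (measurable_gridPoint_mul_groupWeight Q).comp
        ((measurable_pi_apply i).comp measurable_fst)
    have hfC : ∀ h r, |f h r| ≤ (∑ _i : Fin (n + 1), C) * C := fun h r => by
      rw [abs_mul]
      exact mul_le_mul ((Finset.abs_sum_le_sum_abs _ _).trans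
        (Finset.sum_le_sum fun i _ => abs_gridPoint_mul_le (hC _) _))
        (abs_gridPoint_mul_le (hC _) _) (abs_nonneg _) (Finset.sum_nonneg fun _ _ => hC0)
    have h0 : ∀ h, ∫ r, f h r
        ∂(roundKernel Q (calDpPayoff Q N) G hG (calStrategy X κ) τ (n + 1) h) ≤ 0 := fun h => by
      have := τ.isMarkov (n + 1)
      have hfh : Measurable (f h) := hf.of_uncurry_left
      rw [integral_roundKernel Q _ G hG (calStrategy X κ) τ (n + 1) h hfh (hfC h)]
      simp only [f, calStrategy_act_apply, integral_const_mul, integral_mul_const,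
        integral_const, probReal_univ, one_smul, integral_groupWeight Q hQ, mul_zero, le_refl]
    have key := integral_playLaw_nonpos Q (calDpPayoff Q N) G hG (calStrategy X κ) τ n hf hfC h0
    simpa only [f, dpSum, Finset.sum_range] using key

lemma ae_tendsto_dpSum_div (κ : Kernel (Fin N → ℝ) (Fin N)) [IsMarkovKernel κ]
    (Q : Measure (X × Fin 2)) [IsProbabilityMeasure Q] (hQ : ∀ s, 0 < groupProb Q s)
    (G : X × Fin 2 → Γ) (hG : Measurable G)
    (τ : NatureStrategy X (Fin 2) (Fin N) (Fin 2) Γ) :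
    ∀ᵐ ω ∂(playLaw Q (calDpPayoff Q N) G hG (calStrategy X κ) τ),
      Tendsto (fun T : ℕ => dpSum Q T ω / T) atTop (𝓝 0) := by
  obtain ⟨C, hC⟩ := exists_abs_groupWeight_le Q
  have hd : ∀ r : Round X (Fin 2) (Fin N) (Fin 2),
      |gridPoint N r.2.1 * groupWeight Q r.1.2| ≤ C := fun r => abs_gridPoint_mul_le (hC _) _
  have hm : ∀ n, Measurable (dpSum Q n : (ℕ → Round X (Fin 2) (Fin N) (Fin 2)) → ℝ) := fun n =>
    Finset.measurable_sum _ fun t _ =>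
      (measurable_gridPoint_mul_groupWeight Q).comp (measurable_pi_apply t)
  have hinc : ∀ n (ω : ℕ → Round X (Fin 2) (Fin N) (Fin 2)),
      |dpSum Q (n + 1) ω - dpSum Q n ω| ≤ C := fun n ω => by
    simpa [dpSum, Finset.sum_range_succ] using hd (ω n)
  have hbd : ∀ n (ω : ℕ → Round X (Fin 2) (Fin N) (Fin 2)), |dpSum Q n ω| ≤ C * n := fun n ω =>
    abs_le_mul_of_abs_succ_sub_le (u := fun n => dpSum Q n ω) (by simp [dpSum])
      (fun n => hinc n ω) n
  have hC0 : 0 ≤ C := (abs_nonneg _).trans (hC 0)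
  suffices h : ∀ᵐ ω ∂(playLaw Q (calDpPayoff Q N) G hG (calStrategy X κ) τ), ∀ _ : Unit,
      Tendsto (fun T : ℕ => dpSum Q T ω / T) atTop (𝓝 0) from h.mono fun ω hω => hω ()
  -- A one-coordinate potential: `F` is the cross term of the expanded square and `C ^ 2` bounds the
  -- squared increment.
  refine ae_tendsto_div_of_sum_sq_succ_le (U := fun _ => dpSum Q) (C := C) (K := C ^ 2)
    (F := fun n ω => 2 * (dpSum Q n ω * (gridPoint N (ω n).2.1 * groupWeight Q (ω n).1.2)))
    (fun _ => hm) (fun _ ω => by simp [dpSum]) (fun _ => hinc) (fun n => ?_) (fun n => ?_)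
    (fun n ω => ?_)
  · refine Integrable.const_mul (integrable_of_measurable_of_abs_le (C := C * n * C)
      ((hm n).mul ((measurable_gridPoint_mul_groupWeight Q).comp (measurable_pi_apply n)))
      fun ω => ?_) _
    rw [Pi.mul_apply, abs_mul]
    exact mul_le_mul (hbd n ω) (hd _) (abs_nonneg _) (by positivity)
  · rw [integral_const_mul]
    exact mul_nonpos_of_nonneg_of_nonpos zero_le_two (integral_dpSum_mul_nonpos κ Q hQ G hG τ n)
  · have h1 : dpSum Q (n + 1) ω =
        dpSum Q n ω + gridPoint N (ω n).2.1 * groupWeight Q (ω n).1.2 := by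
      simp [dpSum, Finset.sum_range_succ]
    have h2 := sq_le_sq' (abs_le.1 (hd (ω n))).1 (abs_le.1 (hd (ω n))).2
    simp only [Finset.univ_unique, Finset.sum_singleton, h1]
    linarith

end Strategy

/-! ## Blackwell's condition -/

section Blackwell

variable {X Γ : Type*} [MeasurableSpace X] [MeasurableSpace Γ] {N : ℕ}

lemma mem_calDpTarget_iff {w : EuclideanSpace ℝ (Fin N ⊕ Fin 2)} :
    w ∈ calDpTarget N ↔ ∑ k, |w (Sum.inl k)| ≤ 1 / (N : ℝ) ∧
      |w (Sum.inr 0) - w (Sum.inr 1)| ≤ 1 / (N : ℝ) :=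
  Iff.rfl

lemma exists_abs_gridPoint_sub_le (hN : 0 < N) {x : ℝ} (h0 : 0 ≤ x) (h1 : x ≤ 1) :
    ∃ k : Fin N, |gridPoint N k - x| ≤ 1 / (N : ℝ) := by
  have hN' : (0 : ℝ) < N := by exact_mod_cast hN
  -- The witness is the cell that contains `x`; the cap matters only at `x = 1`.
  have hk : min ⌊x * N⌋₊ (N - 1) < N := (min_le_right _ _).trans_lt (Nat.sub_lt hN one_pos)
  refine ⟨⟨min ⌊x * N⌋₊ (N - 1), hk⟩, ?_⟩
  have hfl := Nat.floor_le (mul_nonneg h0 hN'.le)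
  have hlt := Nat.lt_floor_add_one (x * N)
  have hxN : x * N ≤ N := mul_le_of_le_one_left hN'.le h1
  have key : |((min ⌊x * N⌋₊ (N - 1) : ℕ) : ℝ) + 1 / 2 - x * N| ≤ 1 := by
    rw [abs_le]
    rcases le_total ⌊x * N⌋₊ (N - 1) with h | h
    · rw [min_eq_left h]
      constructor <;> linarith
    · rw [min_eq_right h, Nat.cast_pred hN]
      have h' : ((N - 1 : ℕ) : ℝ) ≤ ⌊x * N⌋₊ := by exact_mod_cast h
      rw [Nat.cast_pred hN] at h'
      constructor <;> linarith
  have : gridPoint N ⟨min ⌊x * N⌋₊ (N - 1), hk⟩ - x =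
      (((min ⌊x * N⌋₊ (N - 1) : ℕ) : ℝ) + 1 / 2 - x * N) / N := by
    unfold gridPoint
    field_simp
  rw [this, abs_div, abs_of_pos hN']
  gcongr

lemma meanPayoff_const_dirac_apply (Q : Measure (X × Fin 2)) [IsProbabilityMeasure Q]
    (G : X × Fin 2 → Γ) (hG : Measurable G) (q : Kernel Γ (Fin 2)) [IsMarkovKernel q] (k : Fin N)
    (i : Fin N ⊕ Fin 2) :
    meanPayoff Q (calDpPayoff Q N) G (Kernel.const X (Measure.dirac k)) q i =
      ∫ z, ∑ b, (q (G z)).real {b} * (calDpPayoff Q N).toFun k b z.1 z.2 i ∂Q := by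
  have hq : ∀ b, Measurable fun z => (q (G z)).real {b} := fun b =>
    ((q.measurable_coe (measurableSet_singleton b)).comp hG).ennreal_toReal
  have hs : ∀ z : X × Fin 2, ∑ a, ∑ b,
      ((Kernel.const X (Measure.dirac k) z.1).real {a} * (q (G z)).real {b}) •
        (calDpPayoff Q N).toFun a b z.1 z.2 =
      ∑ b, (q (G z)).real {b} • (calDpPayoff Q N).toFun k b z.1 z.2 := fun z => by
    rw [Finset.sum_eq_single k]
    · simp [Measure.real]
    · intro a _ ha
      simp [Measure.real, Ne.symm ha]
    · simp
  unfold meanPayoff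
  simp only [hs]
  rw [eval_integral_piLp]
  · simp
  intro j
  simp only [WithLp.ofLp_sum, WithLp.ofLp_smul, Finset.sum_apply, Pi.smul_apply, smul_eq_mul]
  refine integrable_finsetSum _ fun b _ => ?_
  obtain ⟨C, hC⟩ := (Set.finite_range fun s : Fin 2 =>
    |(Sum.elim (calPayoff N k b) (dpPayoff Q N k s) : Fin N ⊕ Fin 2 → ℝ) j|).bddAbove
  refine integrable_of_measurable_of_abs_le (C := C) ((hq b).mul
    ((measurable_of_countable fun s : Fin 2 =>
      (Sum.elim (calPayoff N k b) (dpPayoff Q N k s) : Fin N ⊕ Fin 2 → ℝ) j).comp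
      measurable_snd)) fun z => ?_
  have h1 : |(Sum.elim (calPayoff N k b) (dpPayoff Q N k z.2) : Fin N ⊕ Fin 2 → ℝ) j| ≤ C :=
    hC ⟨z.2, rfl⟩
  refine (abs_mul _ _).trans_le ((mul_le_of_le_one_left (abs_nonneg _) ?_).trans h1)
  rw [abs_of_nonneg measureReal_nonneg]
  exact measureReal_le_one

/-- A constant forecast has calibration error on coordinate `k` alone, and the factors `γ_s` cancel,
so both parity coordinates equal `gridPoint N k`. -/
lemma meanPayoff_const_dirac_mem (Q : Measure (X × Fin 2)) [IsProbabilityMeasure Q]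
    (hQ : ∀ s, 0 < groupProb Q s) (G : X × Fin 2 → Γ) (hG : Measurable G) (q : Kernel Γ (Fin 2))
    [IsMarkovKernel q] (k : Fin N)
    (hk : |gridPoint N k - ∫ z, (q (G z)).real {1} ∂Q| ≤ 1 / (N : ℝ)) :
    meanPayoff Q (calDpPayoff Q N) G (Kernel.const X (Measure.dirac k)) q ∈ calDpTarget N := by
  have hq : ∀ z, (q (G z)).real {0} + (q (G z)).real {1} = 1 := fun z => by
    have := sum_measureReal_singleton (μ := q (G z)) Finset.univ
    rw [Fin.sum_univ_two] at this
    simpa using this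
  have hint : Integrable (fun z => (q (G z)).real {1}) Q :=
    integrable_of_measurable_of_abs_le (C := 1)
      ((q.measurable_coe (measurableSet_singleton 1)).comp hG).ennreal_toReal fun z => by
        rw [abs_of_nonneg measureReal_nonneg]
        exact measureReal_le_one
  have hinl : ∀ k', meanPayoff Q (calDpPayoff Q N) G (Kernel.const X (Measure.dirac k)) q
      (Sum.inl k') = if k = k' then gridPoint N k' - ∫ z, (q (G z)).real {1} ∂Q else 0 := by
    intro k'
    rw [meanPayoff_const_dirac_apply Q G hG]
    simp only [calDpPayoff_inl]
    split_ifs with h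
    · have : ∀ z, ∑ b, (q (G z)).real {b} * (gridPoint N k' - outcome b) =
          gridPoint N k' - (q (G z)).real {1} := fun z => by
        rw [Fin.sum_univ_two, show (q (G z)).real {0} = 1 - (q (G z)).real {1} by linarith [hq z]]
        simp only [outcome, Fin.val_zero, Fin.val_one, Nat.cast_zero, Nat.cast_one]
        ring
      simp only [this]
      rw [integral_sub (integrable_const _) hint]
      simp
    · simp
  have hinr : ∀ s, meanPayoff Q (calDpPayoff Q N) G (Kernel.const X (Measure.dirac k)) q
      (Sum.inr s) = gridPoint N k := by
    intro s
    rw [meanPayoff_const_dirac_apply Q G hG]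
    simp only [calDpPayoff_inr, ← Finset.sum_mul, Fin.sum_univ_two, hq, one_mul]
    rw [integral_ite_snd_eq, mul_div_cancel₀ _ (hQ s).ne']
  rw [mem_calDpTarget_iff]
  constructor
  · have : ∀ k', |if k = k' then gridPoint N k' - ∫ z, (q (G z)).real {1} ∂Q else 0| =
        if k = k' then |gridPoint N k' - ∫ z, (q (G z)).real {1} ∂Q| else 0 := fun k' => by
      split_ifs <;> simp
    simp only [hinl, this, Finset.sum_ite_eq, Finset.mem_univ, if_true]
    exact hk
  · simp [hinr]

lemma meanPayoff_const_dirac_mem_of_closest (hN : 0 < N) (Q : Measure (X × Fin 2))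
    [IsProbabilityMeasure Q] (hQ : ∀ s, 0 < groupProb Q s) (G : X × Fin 2 → Γ) (hG : Measurable G)
    (q : Kernel Γ (Fin 2)) [IsMarkovKernel q] (k : Fin N)
    (hk : ∀ k' : Fin N, |gridPoint N k - ∫ z, (q (G z)).real {1} ∂Q| ≤
      |gridPoint N k' - ∫ z, (q (G z)).real {1} ∂Q|) :
    meanPayoff Q (calDpPayoff Q N) G (Kernel.const X (Measure.dirac k)) q ∈ calDpTarget N := by
  have h1 : ∫ z, (q (G z)).real {1} ∂Q ≤ 1 := by
    have := integral_mono_of_nonneg (μ := Q) (f := fun z => (q (G z)).real {1}) (g := fun _ => 1)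
      (Eventually.of_forall fun z => measureReal_nonneg) (integrable_const _)
      (Eventually.of_forall fun z => measureReal_le_one)
    simpa using this
  obtain ⟨k', hk'⟩ := exists_abs_gridPoint_sub_le hN
    (integral_nonneg fun z => measureReal_nonneg) h1
  exact meanPayoff_const_dirac_mem Q hQ G hG q k ((hk k').trans hk')

lemma blackwellCondition_calDp (hN : 0 < N) (Q : Measure (X × Fin 2))
    [IsProbabilityMeasure Q] (hQ : ∀ s, 0 < groupProb Q s) (G : X × Fin 2 → Γ)
    (hG : Measurable G) : BlackwellCondition Q (calDpPayoff Q N) G (calDpTarget N) := by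
  intro q _
  have : NeZero N := ⟨hN.ne'⟩
  obtain ⟨k, -, hk⟩ := Finset.exists_min_image Finset.univ
    (fun k : Fin N => |gridPoint N k - ∫ z, (q (G z)).real {1} ∂Q|) Finset.univ_nonempty
  exact ⟨Kernel.const X (Measure.dirac k), inferInstance,
    meanPayoff_const_dirac_mem_of_closest hN Q hQ G hG q k fun k' => hk k' (Finset.mem_univ _)⟩

end Blackwell

/-! ## Convergence to the target -/

section Target

set_option linter.unusedSectionVars false

variable {X Γ : Type*} [MeasurableSpace X] [MeasurableSpace Γ] {N : ℕ}

lemma avgPayoff_inl (Q : Measure (X × Fin 2)) (ω : ℕ → Round X (Fin 2) (Fin N) (Fin 2)) (T : ℕ)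
    (k : Fin N) :
    avgPayoff (calDpPayoff Q N) ω T (Sum.inl k) = 1 / (T : ℝ) * calSum k T ω := by
  simp [avgPayoff, calDpPayoff_inl, calSum]

lemma calError_eq (ω : ℕ → Round X (Fin 2) (Fin N) (Fin 2)) (T : ℕ) :
    calError ω T = ∑ k, |1 / (T : ℝ) * calSum k T ω| :=
  rfl

lemma dpGap_eq_avgPayoff (Q : Measure (X × Fin 2)) (ω : ℕ → Round X (Fin 2) (Fin N) (Fin 2))
    (T : ℕ) : dpGap Q ω T = |avgPayoff (calDpPayoff Q N) ω T (Sum.inr 0) -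
      avgPayoff (calDpPayoff Q N) ω T (Sum.inr 1)| := by
  have h : ∀ s, avgPayoff (calDpPayoff Q N) ω T (Sum.inr s) = 1 / (groupProb Q s * T) *
      ∑ t ∈ Finset.range T, if (ω t).1.2 = s then gridPoint N (ω t).2.1 else 0 := fun s => by
    simp only [avgPayoff, PiLp.smul_apply, WithLp.ofLp_sum, Finset.sum_apply, calDpPayoff_inr,
      smul_eq_mul, Finset.mul_sum]
    refine Finset.sum_congr rfl fun t _ => ?_
    split_ifs <;> ring
  rw [h, h]
  rfl

lemma dpGap_eq_abs_dpSum_div (Q : Measure (X × Fin 2)) (ω : ℕ → Round X (Fin 2) (Fin N) (Fin 2))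
    (T : ℕ) : dpGap Q ω T = |dpSum Q T ω / T| := by
  unfold dpGap dpSum groupWeight
  congr 1
  rw [Finset.sum_div, Finset.mul_sum, Finset.mul_sum, ← Finset.sum_sub_distrib]
  refine Finset.sum_congr rfl fun t _ => ?_
  split_ifs <;> ring

lemma avgPayoff_mem_calDpTarget_iff (Q : Measure (X × Fin 2))
    (ω : ℕ → Round X (Fin 2) (Fin N) (Fin 2)) (T : ℕ) :
    avgPayoff (calDpPayoff Q N) ω T ∈ calDpTarget N ↔
      calError ω T ≤ 1 / (N : ℝ) ∧ dpGap Q ω T ≤ 1 / (N : ℝ) := by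
  simp only [mem_calDpTarget_iff, avgPayoff_inl, calError_eq, dpGap_eq_avgPayoff]

lemma calError_le (ω : ℕ → Round X (Fin 2) (Fin N) (Fin 2)) {T : ℕ} (hT : 0 < T) :
    calError ω T ≤ 1 / (2 * (N : ℝ)) + ∑ k, |calExcess k T ω / T| := by
  have hT' : (0 : ℝ) < T := by exact_mod_cast hT
  have h : ∀ k : Fin N, |1 / (T : ℝ) * calSum k T ω| ≤
      calTol k T ω / T + |calExcess k T ω / T| := fun k => by
    rw [one_div_mul_eq_div, abs_div, abs_div, abs_of_pos hT', ← add_div]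
    gcongr
    exact abs_le_add_abs_softThreshold (calTol_nonneg k T ω)
  refine (Finset.sum_le_sum fun k _ => h k).trans (le_of_eq ?_)
  rw [Finset.sum_add_distrib, ← Finset.sum_div, sum_calTol, mul_div_cancel_left₀ _ hT'.ne']

/-- For the calibration strategy, both criteria are eventually within the tolerance. -/
lemma ae_eventually_calError_le_and_dpGap_le (hN : 0 < N) (κ : Kernel (Fin N → ℝ) (Fin N))
    [IsMarkovKernel κ] (hκ : ∀ w b, ∫ k, weightedExcess w k b ∂(κ w) ≤ 0)
    (Q : Measure (X × Fin 2)) [IsProbabilityMeasure Q] (hQ : ∀ s, 0 < groupProb Q s)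
    (G : X × Fin 2 → Γ) (hG : Measurable G) (τ : NatureStrategy X (Fin 2) (Fin N) (Fin 2) Γ) :
    ∀ᵐ ω ∂(playLaw Q (calDpPayoff Q N) G hG (calStrategy X κ) τ), ∀ᶠ T in atTop,
      calError ω T ≤ 1 / (N : ℝ) ∧ dpGap Q ω T ≤ 1 / (N : ℝ) := by
  have hN' : (0 : ℝ) < N := by exact_mod_cast hN
  filter_upwards [ae_tendsto_calExcess_div κ hκ Q G hG τ, ae_tendsto_dpSum_div κ Q hQ G hG τ]
    with ω h1 h2
  have h3 : Tendsto (fun T : ℕ => ∑ k : Fin N, |calExcess k T ω / T|) atTop (𝓝 0) := by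
    simpa using tendsto_finsetSum Finset.univ fun k _ => (h1 k).abs
  have h4 : Tendsto (fun T : ℕ => |dpSum Q T ω / T|) atTop (𝓝 0) := by simpa using h2.abs
  -- The vanishing excess is asked to fit in the unused half `1 / (2N)` of the calibration target.
  filter_upwards [h3.eventually_le_const (by positivity : 0 < 1 / (2 * (N : ℝ))),
    h4.eventually_le_const (by positivity : 0 < 1 / (N : ℝ)), eventually_gt_atTop 0]
    with T h5 h6 hT
  refine ⟨(calError_le ω hT).trans ?_, by rwa [dpGap_eq_abs_dpSum_div]⟩
  have : 1 / (N : ℝ) = 1 / (2 * (N : ℝ)) + 1 / (2 * (N : ℝ)) := by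
    field_simp
    norm_num
  linarith

/-- The kernel `κ` is fixed before `Q`, and the strategy reads only calibration coordinates, which
do not involve `Q`. -/
lemma exists_strategy_tendsto_and_limsup_le (X : Type*) [MeasurableSpace X] (hN : 0 < N) :
    ∃ σ : PlayerStrategy X (Fin 2) (Fin N) (Fin N ⊕ Fin 2),
      ∀ (Q : Measure (X × Fin 2)) [IsProbabilityMeasure Q], (∀ s, 0 < groupProb Q s) →
      ∀ (Γ : Type*) [MeasurableSpace Γ] (G : X × Fin 2 → Γ) (hG : Measurable G)
        (τ : NatureStrategy X (Fin 2) (Fin N) (Fin 2) Γ),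
        ∀ᵐ ω ∂(playLaw Q (calDpPayoff Q N) G hG σ τ),
          Tendsto (fun T => Metric.infDist (avgPayoff (calDpPayoff Q N) ω T)
            (calDpTarget N)) atTop (𝓝 0) ∧
          limsup (fun T => calError ω T) atTop ≤ 1 / (N : ℝ) ∧
          limsup (fun T => dpGap Q ω T) atTop ≤ 1 / (N : ℝ) := by
  obtain ⟨κ, _, hκ⟩ := exists_kernel_integral_weightedExcess_nonpos hN
  refine ⟨calStrategy X κ, fun Q _ hQ Γ _ G hG τ => ?_⟩
  filter_upwards [ae_eventually_calError_le_and_dpGap_le hN κ hκ Q hQ G hG τ] with ω hω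
  -- A real `limsup` is bounded above by an eventual bound only if the sequence is cobounded;
  -- nonnegativity provides this.
  have hcob : ∀ u : ℕ → ℝ, (∀ T, 0 ≤ u T) → IsCoboundedUnder (· ≤ ·) atTop u := fun u hu =>
    isCoboundedUnder_le_of_le (x := 0) atTop hu
  refine ⟨?_, ?_, ?_⟩
  · refine tendsto_const_nhds.congr' ?_
    filter_upwards [hω] with T hT
    exact (Metric.infDist_zero_of_mem ((avgPayoff_mem_calDpTarget_iff Q ω T).2 hT)).symm
  · exact limsup_le_of_le (hcob _ fun T => Finset.sum_nonneg fun _ _ => abs_nonneg _)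
      (hω.mono fun T hT => hT.1)
  · exact limsup_le_of_le (hcob _ fun T => abs_nonneg _) (hω.mono fun T hT => hT.2)

end Target

end FairOnline

/-- `Γ` and `G` describe the monitoring of Nature: `Γ = X`, `G = Prod.fst` when Nature is unaware of
the sensitive contexts, and `Γ = X × Fin 2`, `G = id` when it is aware of them. -/
theorem mainTheorem6 {X : Type u} [MeasurableSpace X] (N : ℕ) (hN : 2 ≤ N) :
    (∀ (Q : Measure (X × Fin 2)) [IsProbabilityMeasure Q], (∀ s, 0 < FairOnline.groupProb Q s) →
      ∀ (Γ : Type u) [MeasurableSpace Γ] (G : X × Fin 2 → Γ) (hG : Measurable G),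
        FairOnline.BlackwellCondition Q (FairOnline.calDpPayoff Q N) G
            (FairOnline.calDpTarget N) ∧
        (∀ q : Kernel Γ (Fin 2), IsMarkovKernel q → ∀ k : Fin N,
          (∀ k' : Fin N,
            |FairOnline.gridPoint N k - ∫ z, (q (G z)).real {1} ∂Q| ≤
              |FairOnline.gridPoint N k' - ∫ z, (q (G z)).real {1} ∂Q|) →
          FairOnline.meanPayoff Q (FairOnline.calDpPayoff Q N) G
            (Kernel.const X (Measure.dirac k)) q ∈ FairOnline.calDpTarget N) ∧
        FairOnline.Approachable Q (FairOnline.calDpPayoff Q N) G hG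
          (FairOnline.calDpTarget N)) ∧
    (∃ σ : FairOnline.PlayerStrategy X (Fin 2) (Fin N) (Fin N ⊕ Fin 2),
      ∀ (Q : Measure (X × Fin 2)) [IsProbabilityMeasure Q], (∀ s, 0 < FairOnline.groupProb Q s) →
      ∀ (Γ : Type u) [MeasurableSpace Γ] (G : X × Fin 2 → Γ) (hG : Measurable G)
        (τ : FairOnline.NatureStrategy X (Fin 2) (Fin N) (Fin 2) Γ),
        ∀ᵐ ω ∂(FairOnline.playLaw Q (FairOnline.calDpPayoff Q N) G hG σ τ),
          Tendsto (fun T => Metric.infDist (FairOnline.avgPayoff (FairOnline.calDpPayoff Q N) ω T)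
            (FairOnline.calDpTarget N)) atTop (𝓝 0) ∧
          limsup (fun T => FairOnline.calError ω T) atTop ≤ 1 / (N : ℝ) ∧
          limsup (fun T => FairOnline.dpGap Q ω T) atTop ≤ 1 / (N : ℝ)) := by
  have hN0 : 0 < N := by omega
  obtain ⟨σ, hσ⟩ := FairOnline.exists_strategy_tendsto_and_limsup_le X hN0
  refine ⟨fun Q _ hQ Γ _ G hG => ⟨FairOnline.blackwellCondition_calDp hN0 Q hQ G hG,
    fun q _ k hk => FairOnline.meanPayoff_const_dirac_mem_of_closest hN0 Q hQ G hG q k hk,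
    σ, fun τ => (hσ Q hQ Γ G hG τ).mono fun ω hω => hω.1⟩, σ, fun Q _ hQ Γ _ G hG τ => ?_⟩
  exact hσ Q hQ Γ G hG τ
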